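/- A factorisation circuit $C$ for two sets $A$ and $B$ is a finite acyclic directed graph with a unique sink in which each node without incoming edges (an input gate) is labelled by $\{a\mapsto b\}$ for some $a\in A$, $b\in B$, and every other node is labelled by $\cup$ or $\times$. The nodes are called gates and the edges wires; $g'$ is a child of $g$ if there is a wire from $g'$ to $g$. The domain of an input gate labelled $\{a\mapsto b\}$ is $\{a\}$, and the domain of any other gate is the union of the domains of its children. The circuit is well-defined if all children of every $\cup$-gate $g$ have the same domain as $g$, and distinct children of every $\times$-gate have disjoint domains. Each gate $g$ then represents a set $S_g$ of mappings $\operatorname{dom}(g)\to B$: $S_g=\{\{a\mapsto b\}\}$ for an input gate labelled $\{a\mapsto b\}$, $S_g=S_{g_1}\cup\dots\cup S_{g_r}$ for a $\cup$-gate with children $g_1,\dots,g_r$, and $S_g=\{h_1\cup\dots\cup h_r \mid h_i\in S_{g_i},\ i=1,\dots,r\}$ for a $\times$-gate with children $g_1,\dots,g_r$. The size $\|C\|$ is the number of gates plus the number of wires. For graphs $\mathcal H$ and $\mathcal G$, a d-representation of the set $\operatorname{Hom}(\mathcal H,\mathcal G)$ of homomorphisms from $\mathcal H$ to $\mathcal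 G$ is a well-defined factorisation circuit for $V(\mathcal H)$ and $V(\mathcal G)$ with $S_s=\operatorname{Hom}(\mathcal H,\mathcal G)$ for its sink $s$. Let $\mathcal K_k$ be the complete graph on $k$ vertices. **Theorem 3.** For every integer $k\ge 1$ there is a constant $c>0$, depending only on $k$, such that there are arbitrarily large finite connected simple graphs $\mathcal G$ (that is, for every $N$ there is one whose number $m$ of edges is at least $N$) for which $\operatorname{Hom}(\mathcal K_k,\mathcal G)$ has a d-representation and every d-representation $C$ of it has size $$\|C\|\ \ge\ c\cdot\frac{m^{k/2}}{\log^{3k-1} m}.$$ -/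

import Mathlib

/-- The label of a gate of a factorisation circuit over `A` and `B`: an input label `{a ↦ b}`,
a union or a product. -/
inductive GateLabel (A B : Type*) where
  | input (a : A) (b : B)
  | union
  | prod

/-- A factorisation circuit for `A` and `B`: a finite acyclic directed graph with a unique sink,
whose nodes without incoming edges are exactly those that carry an input label, all other nodes
being labelled by union or product.  `wire g p` says that there is an edge from `g` to `p`, that
is, `g` is a child of `p`. -/
structure FactorisationCircuit (A B : Type*) where
  Gate : Type
  finite_gate : Finite Gate
  wire : Gate → Gate → Prop
  acyclic : ∀ g, ¬ Relation.TransGen wire g g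
  label : Gate → GateLabel A B
  input_iff : ∀ g, (∃ a b, label g = GateLabel.input a b) ↔ ∀ g', ¬ wire g' g
  sink : Gate
  sink_iff : ∀ g, g = sink ↔ ∀ p, ¬ wire g p

namespace FactorisationCircuit

variable {A B : Type*} (C : FactorisationCircuit A B)

/-- The child gates of a gate. -/
def children (g : C.Gate) : Set C.Gate := {g' | C.wire g' g}

/-- `MemDom g a`: the element `a` belongs to the domain of the gate `g`. The domain of an input
gate labelled `{a ↦ b}` is `{a}`, that of any other gate is the union of those of its children. -/
inductive MemDom : C.Gate → A → Prop
  | input (g : C.Gate) (a : A) (b : B) (hg : C.label g = GateLabel.input a b) : MemDom g a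
  | child (g g' : C.Gate) (a : A) (hw : g' ∈ C.children g) (ha : MemDom g' a) : MemDom g a

/-- The domain of a gate. -/
def dom (g : C.Gate) : Set A := {a | C.MemDom g a}

/-- A circuit is well-defined if all children of a union gate have the domain of that gate, and
distinct children of a product gate have disjoint domains. -/
def WellDefined : Prop :=
  (∀ g, C.label g = GateLabel.union → ∀ g' ∈ C.children g, C.dom g' = C.dom g) ∧
  (∀ g, C.label g = GateLabel.prod → ∀ g₁ ∈ C.children g, ∀ g₂ ∈ C.children g,
    g₁ ≠ g₂ → Disjoint (C.dom g₁) (C.dom g₂))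

/-- `MemS g h`: the mapping `h`, given as its set of pairs `(a, h a)`, belongs to `S_g`. Here
`S_g` consists of `{a ↦ b}` alone for an input gate labelled `{a ↦ b}`, is the union of the sets of
the children for a union gate, and consists of all unions `h₁ ∪ ⋯ ∪ h_r`, with one mapping from the
set of each child, for a product gate. -/
inductive MemS : C.Gate → Set (A × B) → Prop
  | input (g : C.Gate) (a : A) (b : B) (hg : C.label g = GateLabel.input a b) : MemS g {(a, b)}
  | union (g g' : C.Gate) (h : Set (A × B)) (hg : C.label g = GateLabel.union)
      (hw : g' ∈ C.children g) (hh : MemS g' h) : MemS g h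
  | prod (g : C.Gate) (f : C.Gate → Set (A × B)) (hg : C.label g = GateLabel.prod)
      (hf : ∀ g' ∈ C.children g, MemS g' (f g')) : MemS g (⋃ g' ∈ C.children g, f g')

/-- The set `S_g` of mappings represented by the gate `g`. -/
def S (g : C.Gate) : Set (Set (A × B)) := {h | C.MemS g h}

/-- The size of a circuit: the number of gates plus the number of wires. -/
noncomputable def size : ℕ := Nat.card C.Gate + {w : C.Gate × C.Gate | C.wire w.1 w.2}.ncard

/-- `C` is a d-representation of `Hom(H, G)`: it is well-defined and the set of mappings that its
sink represents is the set of (graphs of) homomorphisms from `H` to `G`. -/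
def IsDRep (H : SimpleGraph A) (G : SimpleGraph B) : Prop :=
  C.WellDefined ∧ C.S C.sink = {h | ∃ φ : H →g G, h = {p : A × B | φ p.1 = p.2}}

end FactorisationCircuit

/-!
The lower bound has two ingredients.

*Circuits.* Let `G` contain no complete bipartite graph with `t + 1` vertices on each side, and let
`C` represent the homomorphisms from a complete graph to `G`. If `h ∈ S_g` and `e` completes every
member of `S_g` to a homomorphism, then each value of `h` is adjacent to each value of `e`. So
either `S_g` takes at most `t` values (call `g` small) or the contexts `e` of `g` do
(`ncard_values_context_le`). Follow a homomorphism from the sink down the circuit, staying at gates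
that are not small. As input gates are small, the walk ends at a gate `p` that is not small, being
either a union gate, left through a wire to a small child, or a product gate with small children
only (`exists_rectangle`). There the contexts of `p` have at most `t` values, too, so at most
`(2t)^k` homomorphisms leave the walk at the same place. As there are at most `‖C‖` places, the
number of homomorphisms is at most `‖C‖ (2t)^k` (`card_hom_le_size_mul`).

*Graphs.* By the first moment method some graph on `n = 2 ^ r` vertices has no complete bipartite
subgraph with sides `2r + 1`, while a constant fraction of all maps from `k` points are
homomorphisms from `K_k` (`exists_bicliqueFree_card_hom`). Adding a universal vertex makes it
connected. With `m ≤ n ^ 2` and `t` of order `log m`, this gives `‖C‖ ≥ c m^(k/2) / log^k m`, and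
`k ≤ 3k - 1`.
-/

/-! ### Rectangles in factorisation circuits -/

namespace FactorisationCircuit

variable {A B : Type*} (C : FactorisationCircuit A B)

/-- The values taken by the mappings of a family. -/
def values (T : Set (Set (A × B))) : Set B := {b | ∃ h ∈ T, ∃ a, (a, b) ∈ h}

/-- The contexts of a gate `g`: the partial mappings, defined off the domain of `g`, that complete
every mapping of `S_g` to a mapping represented by the circuit. -/
def context (g : C.Gate) : Set (Set (A × B)) :=
  {e | (∀ p ∈ e, p.1 ∉ C.dom g) ∧ ∀ h ∈ C.S g, h ∪ e ∈ C.S C.sink}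

/-- The mappings of the form `h ∪ e` with `h ∈ S_g` and `e` a context of `p`. -/
def rectangle (g p : C.Gate) : Set (Set (A × B)) :=
  {x | ∃ h ∈ C.S g, ∃ e ∈ C.context p, x = h ∪ e}

variable {C}

lemma fst_mem_dom {g : C.Gate} {h : Set (A × B)} (hh : C.MemS g h) :
    ∀ p ∈ h, p.1 ∈ C.dom g := by
  induction hh with
  | input g a b hg =>
    rintro p rfl
    exact MemDom.input g a b hg
  | union g g' h hg hw hh ih => exact fun p hp => MemDom.child g g' _ hw (ih p hp)
  | prod g f hg hf ih =>
    intro p hp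
    obtain ⟨g', hg', hp⟩ := Set.mem_iUnion₂.1 hp
    exact MemDom.child g g' _ hg' (ih g' hg' p hp)

lemma memDom_input_iff {g : C.Gate} {a a' : A} {b : B} (hg : C.label g = GateLabel.input a b) :
    C.MemDom g a' ↔ a' = a := by
  constructor
  · intro h
    cases h with
    | input b' hg' => simp_all
    | child _ g' _ hw => exact absurd hw ((C.input_iff g).1 ⟨a, b, hg⟩ g')
  · rintro rfl
    exact MemDom.input g a' b hg

lemma memS_input_iff {g : C.Gate} {a : A} {b : B} (hg : C.label g = GateLabel.input a b)
    {h : Set (A × B)} : C.MemS g h ↔ h = {(a, b)} := by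
  constructor
  · intro hh
    cases hh <;> simp_all
  · rintro rfl
    exact MemS.input g a b hg

lemma memS_union_iff {g : C.Gate} (hg : C.label g = GateLabel.union) {h : Set (A × B)} :
    C.MemS g h ↔ ∃ g' ∈ C.children g, C.MemS g' h := by
  constructor
  · intro hh
    cases hh with
    | input a b hg' => simp_all
    | union _ g' _ _ hw hh => exact ⟨g', hw, hh⟩
    | prod f hg' => simp_all
  · rintro ⟨g', hw, hh⟩
    exact MemS.union g g' h hg hw hh

lemma memS_prod_iff {g : C.Gate} (hg : C.label g = GateLabel.prod) {h : Set (A × B)} :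
    C.MemS g h ↔ ∃ f : C.Gate → Set (A × B),
      (∀ g' ∈ C.children g, C.MemS g' (f g')) ∧ h = ⋃ g' ∈ C.children g, f g' := by
  constructor
  · intro hh
    cases hh with
    | input a b hg' => simp_all
    | union => simp_all
    | prod _ f _ hf => exact ⟨f, hf, rfl⟩
  · rintro ⟨f, hf, rfl⟩
    exact MemS.prod g f hg hf

/-- Walking down from a gate that is not small, and staying at gates that are not small as long as
possible, one reaches a union gate entering a small child or a product gate all of whose children
are small. The rectangles at these places therefore cover all represented mappings. -/
lemma exists_rectangle (hC : C.WellDefined) (small : C.Gate → Prop)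
    (hinput : ∀ g a b, C.label g = GateLabel.input a b → small g)
    {g : C.Gate} {h : Set (A × B)} (hh : C.MemS g h) :
    ∀ e ∈ C.context g, ¬ small g →
      (∃ g' p, C.wire g' p ∧ ¬ small p ∧ small g' ∧ h ∪ e ∈ C.rectangle g' p) ∨
      (∃ p, C.label p = GateLabel.prod ∧ ¬ small p ∧ (∀ g' ∈ C.children p, small g') ∧
        h ∪ e ∈ C.rectangle p p) := by
  classical
  induction hh with
  | input g a b hg => exact fun e _ hs => absurd (hinput g a b hg) hs
  | union g g' h hg hw hh ih =>
    intro e he hs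
    by_cases hs' : small g'
    · exact Or.inl ⟨g', g, hw, hs, hs', h, hh, e, he, rfl⟩
    · exact ih e ⟨fun p hp hpg => he.1 p hp (MemDom.child g g' _ hw hpg),
        fun h₁ h₁S => he.2 h₁ (MemS.union g g' h₁ hg hw h₁S)⟩ hs'
  | prod g f hg hf ih =>
    intro e he hs
    by_cases hall : ∀ g' ∈ C.children g, small g'
    · exact Or.inr ⟨g, hg, hs, hall, _, MemS.prod g f hg hf, e, he, rfl⟩
    push Not at hall
    obtain ⟨g₀, hg₀, hs₀⟩ := hall
    -- The parts contributed by the siblings of `g₀` join the context.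
    have key : ∀ f' : C.Gate → Set (A × B), (∀ g' ≠ g₀, f' g' = f g') →
        (⋃ g' ∈ C.children g, f' g') ∪ e =
          f' g₀ ∪ ((⋃ g' ∈ C.children g \ {g₀}, f g') ∪ e) := by
      intro f' hf'
      rw [← Set.union_assoc]
      congr 1
      ext x
      simp only [Set.mem_iUnion, Set.mem_union, Set.mem_sdiff, Set.mem_singleton_iff, exists_prop]
      constructor
      · rintro ⟨g', hg', hx⟩
        by_cases hgg : g' = g₀
        · exact Or.inl (hgg ▸ hx)
        · exact Or.inr ⟨g', ⟨hg', hgg⟩, hf' g' hgg ▸ hx⟩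
      · rintro (hx | ⟨g', ⟨hg', hgg⟩, hx⟩)
        · exact ⟨g₀, hg₀, hx⟩
        · exact ⟨g', hg', (hf' g' hgg).symm ▸ hx⟩
    rw [key f fun _ _ => rfl]
    refine ih g₀ hg₀ _ ⟨?_, ?_⟩ hs₀
    · rintro p (hp | hp) hp₀
      · simp only [Set.mem_iUnion, Set.mem_sdiff, Set.mem_singleton_iff, exists_prop] at hp
        obtain ⟨g', ⟨hg', hgg⟩, hp⟩ := hp
        exact Set.disjoint_left.1 (hC.2 g hg g' hg' g₀ hg₀ hgg)
          (fst_mem_dom (hf g' hg') p hp) hp₀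
      · exact he.1 p hp (MemDom.child g g₀ _ hg₀ hp₀)
    · intro h₁ h₁S
      have h₂ := key (Function.update f g₀ h₁) fun g' hgg => Function.update_of_ne hgg _ _
      rw [Function.update_self] at h₂
      rw [← h₂]
      refine he.2 _ (MemS.prod g _ hg fun g' hg' => ?_)
      by_cases hgg : g' = g₀
      · subst hgg
        rw [Function.update_self]
        exact h₁S
      · rw [Function.update_of_ne hgg]
        exact hf g' hg'

end FactorisationCircuit

/-- `G` contains no complete bipartite graph with both sides of size at least `s`. -/
def BicliqueFree {V : Type*} (G : SimpleGraph V) (s : ℕ) : Prop :=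
  ∀ X Y : Finset V, (∀ x ∈ X, ∀ y ∈ Y, G.Adj x y) → s ≤ X.card → Y.card < s

lemma ncard_functions_le {A B : Type*} [Fintype A] [Finite B] (V : A → Set B) {K : ℕ}
    (hV : ∀ a, (V a).ncard ≤ K) : {φ : A → B | ∀ a, φ a ∈ V a}.ncard ≤ K ^ Fintype.card A := by
  classical
  have := Fintype.ofFinite B
  have h : {φ : A → B | ∀ a, φ a ∈ V a} =
      (Fintype.piFinset fun a => (V a).toFinset : Finset (A → B)) := by
    ext φ; simp
  rw [h, Set.ncard_coe_finset, Fintype.card_piFinset]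
  refine (Finset.prod_le_pow_card _ _ K fun a _ => ?_).trans (by simp)
  rw [← Set.ncard_eq_toFinset_card']
  exact hV a

lemma ncard_iUnion_le_card_mul {ι α : Type*} [Finite ι] [Finite α] (R : ι → Set α) {K : ℕ}
    (hR : ∀ i, (R i).ncard ≤ K) : (⋃ i, R i).ncard ≤ Nat.card ι * K := by
  classical
  have := Fintype.ofFinite ι
  have := Fintype.ofFinite α
  have h : (⋃ i, R i) = ((Finset.univ.biUnion fun i => (R i).toFinset : Finset α) : Set α) := by
    ext; simp
  rw [h, Set.ncard_coe_finset, Nat.card_eq_fintype_card]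
  refine Finset.card_biUnion_le_card_mul _ _ K fun i _ => ?_
  rw [← Set.ncard_eq_toFinset_card']
  exact hR i

namespace FactorisationCircuit

variable {A B : Type*} {C : FactorisationCircuit A B}

/-- In a circuit for the homomorphisms of a complete graph, every value of a gate is adjacent to
every value of its contexts, so a biclique-free target leaves one of the two sides small. -/
lemma ncard_values_context_le [Finite B] {G : SimpleGraph B} {t : ℕ}
    (hG : BicliqueFree G (t + 1)) (hC : C.IsDRep (⊤ : SimpleGraph A) G) {p : C.Gate}
    (hp : ¬ (values (C.S p)).ncard ≤ t) : (values (C.context p)).ncard ≤ t := by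
  classical
  have := Fintype.ofFinite B
  have h := hG (values (C.S p)).toFinset (values (C.context p)).toFinset ?_ ?_
  · rw [Set.ncard_eq_toFinset_card']
    omega
  · intro x hx y hy
    rw [Set.mem_toFinset] at hx hy
    obtain ⟨h, hh, a, ha⟩ := hx
    obtain ⟨e, he, a', ha'⟩ := hy
    have hS := he.2 h hh
    rw [hC.2] at hS
    obtain ⟨φ, hφ⟩ := hS
    have h₁ : φ a = x := by
      have : (a, x) ∈ h ∪ e := Or.inl ha
      rwa [hφ] at this
    have h₂ : φ a' = y := by
      have : (a', y) ∈ h ∪ e := Or.inr ha'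
      rwa [hφ] at this
    rw [← h₁, ← h₂]
    refine φ.map_adj ?_
    rw [SimpleGraph.top_adj]
    intro haa
    exact he.1 _ ha' (haa ▸ fst_mem_dom hh (a, x) ha)
  · rw [← Set.ncard_eq_toFinset_card']
    omega

/-- The number of functions whose graph lies in the rectangle of a wire with a small lower end. -/
lemma ncard_rectangle_le_of_small [Fintype A] [Finite B] {g p : C.Gate} {t : ℕ}
    (hg : (values (C.S g)).ncard ≤ t) (hp : (values (C.context p)).ncard ≤ t) :
    {φ : A → B | {x : A × B | φ x.1 = x.2} ∈ C.rectangle g p}.ncard ≤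
      (2 * t) ^ Fintype.card A := by
  refine (Set.ncard_le_ncard ?_ (Set.toFinite _)).trans
    (ncard_functions_le (fun _ => values (C.S g) ∪ values (C.context p))
      fun _ => (Set.ncard_union_le _ _).trans (by omega))
  rintro φ ⟨h, hh, e, he, hφ⟩ a
  have : (a, φ a) ∈ h ∪ e := hφ ▸ rfl
  exact this.imp (fun hx => ⟨h, hh, a, hx⟩) (fun hx => ⟨e, he, a, hx⟩)

/-- The number of functions whose graph lies in the rectangle of a product gate with small
children. -/
lemma ncard_rectangle_le_of_prod [Fintype A] [Finite B] (hC : C.WellDefined) {p : C.Gate} {t : ℕ}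
    (hprod : C.label p = GateLabel.prod) (hg : ∀ g ∈ C.children p, (values (C.S g)).ncard ≤ t)
    (hp : (values (C.context p)).ncard ≤ t) :
    {φ : A → B | {x : A × B | φ x.1 = x.2} ∈ C.rectangle p p}.ncard ≤
      (2 * t) ^ Fintype.card A := by
  refine (Set.ncard_le_ncard ?_ (Set.toFinite _)).trans
    (ncard_functions_le (fun a => {b | ∃ h ∈ C.S p, (a, b) ∈ h} ∪ values (C.context p))
      fun a => (Set.ncard_union_le _ _).trans ?_)
  · rintro φ ⟨h, hh, e, he, hφ⟩ a
    have : (a, φ a) ∈ h ∪ e := hφ ▸ rfl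
    exact this.imp (fun hx => ⟨h, hh, hx⟩) (fun hx => ⟨e, he, a, hx⟩)
  -- By disjointness of domains only one child contributes values at `a`.
  have hchild : ∀ b ∈ {b | ∃ h ∈ C.S p, (a, b) ∈ h},
      ∃ g ∈ C.children p, a ∈ C.dom g ∧ b ∈ values (C.S g) := by
    rintro b ⟨h, hh, hb⟩
    obtain ⟨f, hf, rfl⟩ := (memS_prod_iff hprod).1 hh
    obtain ⟨g, hgp, hb⟩ := Set.mem_iUnion₂.1 hb
    exact ⟨g, hgp, fst_mem_dom (hf g hgp) _ hb, f g, hf g hgp, a, hb⟩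
  have : {b | ∃ h ∈ C.S p, (a, b) ∈ h}.ncard ≤ t := by
    obtain hempty | ⟨b₀, hb₀⟩ := Set.eq_empty_or_nonempty {b | ∃ h ∈ C.S p, (a, b) ∈ h}
    · simp [hempty]
    obtain ⟨g₀, hg₀, ha₀, -⟩ := hchild b₀ hb₀
    refine (Set.ncard_le_ncard ?_ (Set.toFinite _)).trans (hg g₀ hg₀)
    intro b hb
    obtain ⟨g, hgp, ha, hbg⟩ := hchild b hb
    by_cases hgg : g = g₀
    · exact hgg ▸ hbg
    · exact absurd ha₀ (Set.disjoint_left.1 (hC.2 p hprod g hgp g₀ hg₀ hgg) ha)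
  omega

lemma size_eq_card : C.size = Nat.card (C.Gate ⊕ {w : C.Gate × C.Gate // C.wire w.1 w.2}) := by
  have := C.finite_gate
  rw [Nat.card_sum]
  rfl

/-- The lower bound for the size of a circuit: each of its gates and wires accounts for at most
`(2t)^|A|` homomorphisms. -/
lemma card_hom_le_size_mul [Fintype A] [Finite B] {G : SimpleGraph B} {t : ℕ}
    (hG : BicliqueFree G (t + 1)) (ht : 1 ≤ t) (hC : C.IsDRep (⊤ : SimpleGraph A) G) :
    Nat.card ((⊤ : SimpleGraph A) →g G) ≤ C.size * (2 * t) ^ Fintype.card A := by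
  classical
  have := C.finite_gate
  let Q : C.Gate ⊕ {w : C.Gate × C.Gate // C.wire w.1 w.2} → Set (A → B)
    | Sum.inl p => {φ | {x : A × B | φ x.1 = x.2} ∈ C.rectangle p p}
    | Sum.inr w => {φ | {x : A × B | φ x.1 = x.2} ∈ C.rectangle w.1.1 w.1.2}
  -- Rectangles that are too large are emptied; the covering below does not need them.
  let R := fun i => {φ ∈ Q i | (Q i).ncard ≤ (2 * t) ^ Fintype.card A}
  have hR : ∀ i, (R i).ncard ≤ (2 * t) ^ Fintype.card A := by
    intro i
    by_cases hi : (Q i).ncard ≤ (2 * t) ^ Fintype.card A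
    · exact (Set.ncard_le_ncard (fun φ hφ => hφ.1) (Set.toFinite _)).trans hi
    · have : R i = ∅ := by
        ext φ; simp [R, hi]
      simp [this]
  have hinput : ∀ g a b, C.label g = GateLabel.input a b → (values (C.S g)).ncard ≤ t := by
    intro g a b hg
    refine le_trans (Set.ncard_le_ncard (t := {b}) ?_ (Set.toFinite _)) (by simpa using ht)
    rintro b' ⟨h, hh, a', hb'⟩
    rw [(memS_input_iff hg).1 hh] at hb'
    exact (Prod.mk.inj hb').2
  have hmem : ∀ φ : (⊤ : SimpleGraph A) →g G, {x : A × B | φ x.1 = x.2} ∈ C.S C.sink := by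
    intro φ
    rw [hC.2]
    exact ⟨φ, rfl⟩
  have hempty : ∅ ∈ C.context C.sink := ⟨by simp, fun h hh => by simpa using hh⟩
  have hinj : Function.Injective (fun φ : (⊤ : SimpleGraph A) →g G => (φ : A → B)) :=
    DFunLike.coe_injective
  rw [← Nat.card_range_of_injective hinj]
  by_cases hs : (values (C.S C.sink)).ncard ≤ t
  · have hsize : 1 ≤ C.size :=
      le_add_right (Nat.card_pos_iff.2 ⟨⟨C.sink⟩, C.finite_gate⟩)
    calc (Set.range fun φ : (⊤ : SimpleGraph A) →g G => (φ : A → B)).ncard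
        ≤ (2 * t) ^ Fintype.card A := by
          refine (Set.ncard_le_ncard ?_ (Set.toFinite _)).trans
            (ncard_functions_le (fun _ => values (C.S C.sink)) fun _ => by omega)
          rintro _ ⟨φ, rfl⟩ a
          exact ⟨_, hmem φ, a, rfl⟩
      _ ≤ C.size * (2 * t) ^ Fintype.card A := Nat.le_mul_of_pos_left _ hsize
  have hcover : Set.range (fun φ : (⊤ : SimpleGraph A) →g G => (φ : A → B)) ⊆ ⋃ i, R i := by
    rintro _ ⟨φ, rfl⟩
    rw [Set.mem_iUnion]
    rcases exists_rectangle hC.1 (fun g => (values (C.S g)).ncard ≤ t) hinput (hmem φ) ∅ hempty hs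
      with ⟨g, p, hw, hp, hg, hx⟩ | ⟨p, hprod, hp, hg, hx⟩
    · rw [Set.union_empty] at hx
      exact ⟨Sum.inr ⟨(g, p), hw⟩, hx,
        ncard_rectangle_le_of_small hg (ncard_values_context_le hG hC hp)⟩
    · rw [Set.union_empty] at hx
      exact ⟨Sum.inl p, hx,
        ncard_rectangle_le_of_prod hC.1 hprod hg (ncard_values_context_le hG hC hp)⟩
  rw [size_eq_card]
  exact (Set.ncard_le_ncard hcover (Set.toFinite _)).trans (ncard_iUnion_le_card_mul R hR)

end FactorisationCircuit

/-! ### Random graphs -/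

open Finset in
/-- A complete bipartite graph with sides `s` in a graph on `n` vertices is present in at most a
`n ^ (2 s) / 2 ^ (s ^ 2)` fraction of the edge sets. -/
lemma card_not_bicliqueFree_mul_le {V : Type*} [Fintype V] [DecidableEq V] (s : ℕ)
    [DecidablePred fun F : Finset (Sym2 V) =>
      ¬ BicliqueFree (SimpleGraph.fromEdgeSet (F : Set (Sym2 V))) s] :
    #{F : Finset (Sym2 V) | ¬ BicliqueFree (SimpleGraph.fromEdgeSet (F : Set (Sym2 V))) s}
        * 2 ^ s ^ 2 ≤
      Fintype.card V ^ (2 * s) * 2 ^ Fintype.card (Sym2 V) := by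
  let P : Finset (Finset V × Finset V) :=
    {p ∈ powersetCard s univ ×ˢ powersetCard s univ | Disjoint p.1 p.2}
  let E : Finset V × Finset V → Finset (Sym2 V) := fun p => (p.1 ×ˢ p.2).image fun x => s(x.1, x.2)
  have hE : ∀ p ∈ P, #(E p) = s ^ 2 := by
    rintro ⟨X, Y⟩ hp
    simp only [P, mem_filter, mem_product, mem_powersetCard, subset_univ, true_and] at hp
    obtain ⟨⟨hX, hY⟩, hd⟩ := hp
    rw [card_image_of_injOn, card_product, hX, hY, sq]
    rintro ⟨a, b⟩ hab ⟨c, d⟩ hcd h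
    simp only [coe_product, Set.mem_prod, mem_coe] at hab hcd
    rcases Sym2.eq_iff.1 h with ⟨h₁, h₂⟩ | ⟨h₁, h₂⟩
    · exact Prod.ext h₁ h₂
    · simp only at h₁
      exact absurd (h₁ ▸ hab.1) (Finset.disjoint_right.1 hd hcd.2)
  have hsub : ({F : Finset (Sym2 V) |
      ¬ BicliqueFree (SimpleGraph.fromEdgeSet (F : Set (Sym2 V))) s} : Finset _) ⊆
      P.biUnion fun p => Icc (E p) univ := by
    intro F hF
    have hF := (mem_filter.1 hF).2
    unfold BicliqueFree at hF
    push Not at hF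
    obtain ⟨X, Y, hadj, hX, hY⟩ := hF
    obtain ⟨X', hX', hX's⟩ := exists_subset_card_eq hX
    obtain ⟨Y', hY', hY's⟩ := exists_subset_card_eq hY
    refine mem_biUnion.2 ⟨(X', Y'), ?_, ?_⟩
    · simp only [P, mem_filter, mem_product, mem_powersetCard, subset_univ, true_and]
      refine ⟨⟨hX's, hY's⟩, Finset.disjoint_left.2 fun a ha ha' => ?_⟩
      exact (hadj a (hX' ha) a (hY' ha')).ne rfl
    · simp only [mem_Icc, subset_univ, and_true, E]
      intro e he
      obtain ⟨⟨a, b⟩, hab, rfl⟩ := mem_image.1 he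
      rw [mem_product] at hab
      simpa using ((SimpleGraph.fromEdgeSet_adj _).1
        (hadj a (hX' hab.1) b (hY' hab.2))).1
  have hP : #P ≤ Fintype.card V ^ (2 * s) := by
    refine (card_filter_le _ _).trans ?_
    rw [card_product, card_powersetCard, card_univ, two_mul, pow_add]
    exact Nat.mul_le_mul (Nat.choose_le_pow _ _) (Nat.choose_le_pow _ _)
  calc _ ≤ (∑ p ∈ P, #(Icc (E p) univ)) * 2 ^ s ^ 2 := by
        gcongr
        exact (card_le_card hsub).trans card_biUnion_le
    _ = ∑ p ∈ P, 2 ^ Fintype.card (Sym2 V) := by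
        rw [sum_mul]
        refine sum_congr rfl fun p hp => ?_
        rw [card_Icc_finset (subset_univ _), ← pow_add, card_univ, ← hE p hp,
          Nat.sub_add_cancel (card_le_univ _)]
    _ ≤ _ := by
        rw [sum_const, smul_eq_mul]
        gcongr

open Finset in
/-- An injective map from `k` points is a homomorphism of the complete graph for at least a
`2 ^ (- k ^ 2)` fraction of the edge sets. -/
lemma le_sum_card_hom {V : Type*} [Fintype V] [DecidableEq V] (k : ℕ) :
    (Fintype.card V).descFactorial k * 2 ^ Fintype.card (Sym2 V) ≤
      (∑ F : Finset (Sym2 V), Nat.card ((⊤ : SimpleGraph (Fin k)) →g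
        SimpleGraph.fromEdgeSet (F : Set (Sym2 V)))) * 2 ^ k ^ 2 := by
  classical
  let E : (Fin k ↪ V) → Finset (Sym2 V) := fun φ =>
    (univ : Finset (Fin k × Fin k)).image fun x => s(φ x.1, φ x.2)
  have hE : ∀ φ, #(E φ) ≤ k ^ 2 := fun φ => card_image_le.trans (by simp [sq])
  have hhom : ∀ F : Finset (Sym2 V), #{φ : Fin k ↪ V | E φ ⊆ F} ≤
      Nat.card ((⊤ : SimpleGraph (Fin k)) →g SimpleGraph.fromEdgeSet (F : Set (Sym2 V))) := by
    intro F
    rw [← Fintype.card_coe, ← Nat.card_eq_fintype_card]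
    refine Nat.card_le_card_of_injective
      (fun φ => ⟨φ.1, fun {a b} hab => (SimpleGraph.fromEdgeSet_adj _).2
        ⟨(mem_filter.1 φ.2).2 (mem_image.2 ⟨(a, b), mem_univ _, rfl⟩),
          fun h => hab.ne (φ.1.injective h)⟩⟩) ?_
    intro φ ψ h
    ext a
    exact DFunLike.congr_fun h a
  calc _ = ∑ φ : Fin k ↪ V, 2 ^ Fintype.card (Sym2 V) := by
        rw [sum_const, card_univ, Fintype.card_embedding_eq, Fintype.card_fin, smul_eq_mul]
    _ ≤ ∑ φ : Fin k ↪ V, #{F : Finset (Sym2 V) | E φ ⊆ F} * 2 ^ k ^ 2 := by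
        refine sum_le_sum fun φ _ => ?_
        have : ({F : Finset (Sym2 V) | E φ ⊆ F} : Finset _) = Icc (E φ) univ := by
          ext F; simp
        rw [this, card_Icc_finset (subset_univ _), ← pow_add, card_univ]
        refine Nat.pow_le_pow_right two_pos ?_
        have := hE φ
        omega
    _ = (∑ F : Finset (Sym2 V), #{φ : Fin k ↪ V | E φ ⊆ F}) * 2 ^ k ^ 2 := by
        rw [← sum_mul]
        congr 1
        simp only [card_filter]
        exact sum_comm
    _ ≤ _ := by
        gcongr with F
        exact hhom F

lemma card_hom_le_pow {V : Type*} [Fintype V] (k : ℕ) (G : SimpleGraph V) :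
    Nat.card ((⊤ : SimpleGraph (Fin k)) →g G) ≤ Fintype.card V ^ k := by
  classical
  refine (Nat.card_le_card_of_injective _ (DFunLike.coe_injective (F := _ →g G))).trans ?_
  simp

lemma pow_le_two_pow_mul_descFactorial {n k : ℕ} (h : 2 * k ≤ n) :
    n ^ k ≤ 2 ^ k * n.descFactorial k :=
  calc n ^ k ≤ (2 * (n + 1 - k)) ^ k := Nat.pow_le_pow_left (by omega) k
    _ = 2 ^ k * (n + 1 - k) ^ k := mul_pow _ _ _
    _ ≤ _ := Nat.mul_le_mul_left _ (Nat.pow_sub_le_descFactorial n k)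

/-- By the first moment method, some graph on `2 ^ r` vertices has a positive proportion of all
possible homomorphisms from `K_k` and no complete bipartite graph with sides `2 r + 1`. -/
lemma exists_bicliqueFree_card_hom {k r : ℕ} (hr : k ^ 2 + k + 1 ≤ r) :
    ∃ G : SimpleGraph (Fin (2 ^ r)), BicliqueFree G (2 * r + 1) ∧
      (2 ^ r) ^ k ≤ Nat.card ((⊤ : SimpleGraph (Fin k)) →g G) * 2 ^ (k ^ 2 + k + 1) := by
  classical
  by_contra! hcon
  set n := 2 ^ r with hn
  have hkn : 2 * k ≤ n := by
    have h₁ : k < 2 ^ k := Nat.lt_two_pow_self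
    have h₂ : 2 ^ (k + 1) ≤ 2 ^ r := Nat.pow_le_pow_right two_pos (by nlinarith)
    rw [pow_succ] at h₂
    omega
  set s := 2 * r + 1 with hs
  let M := Fintype.card (Sym2 (Fin n))
  let X : Finset (Sym2 (Fin n)) → ℕ := fun F => Nat.card ((⊤ : SimpleGraph (Fin k)) →g
    SimpleGraph.fromEdgeSet (F : Set (Sym2 (Fin n))))
  let bad : Finset (Finset (Sym2 (Fin n))) := Finset.univ.filter fun F =>
    ¬ BicliqueFree (SimpleGraph.fromEdgeSet (F : Set (Sym2 (Fin n)))) s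
  -- The union bound: `n ^ (2 s) / 2 ^ (s ^ 2) = 2 ^ (- s)` for `n = 2 ^ r`.
  have hbad : bad.card * 2 ^ s ≤ 2 ^ M := by
    have h := card_not_bicliqueFree_mul_le (V := Fin n) s
    have h₁ : (2 : ℕ) ^ s ^ 2 = 2 ^ (r * (2 * s)) * 2 ^ s := by
      rw [← pow_add]; congr 1; rw [hs]; ring
    rw [Fintype.card_fin, hn, ← pow_mul, h₁] at h
    refine Nat.le_of_mul_le_mul_left ?_ (Nat.two_pow_pos (r * (2 * s)))
    calc _ = bad.card * (2 ^ (r * (2 * s)) * 2 ^ s) := by ring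
      _ ≤ _ := h
  have hbad' : bad.card * 2 ^ (k ^ 2 + k + 1) < 2 ^ M := by
    have h₁ : (2 : ℕ) ^ s = 2 ^ (k ^ 2 + k + 1) * 2 ^ (s - (k ^ 2 + k + 1)) := by
      rw [← pow_add]; congr 1; omega
    have h₂ : 2 ^ 1 ≤ 2 ^ (s - (k ^ 2 + k + 1)) := Nat.pow_le_pow_right two_pos (by omega)
    have h₃ : 0 < 2 ^ M := by positivity
    rw [h₁] at hbad
    nlinarith
  have hsum : ∑ F, X F * 2 ^ (k ^ 2 + k + 1) ≤
      2 ^ M * n ^ k + bad.card * (n ^ k * 2 ^ (k ^ 2 + k + 1)) := by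
    have hF : ∀ F, X F * 2 ^ (k ^ 2 + k + 1) ≤
        n ^ k + if F ∈ bad then n ^ k * 2 ^ (k ^ 2 + k + 1) else 0 := by
      intro F
      split_ifs with h
      · have h₁ := card_hom_le_pow k (SimpleGraph.fromEdgeSet (F : Set (Sym2 (Fin n))))
        rw [Fintype.card_fin] at h₁
        exact (Nat.mul_le_mul_right _ h₁).trans (Nat.le_add_left _ _)
      · simp only [bad, Finset.mem_filter, Finset.mem_univ, true_and, not_not] at h
        exact (hcon _ h).le
    refine (Finset.sum_le_sum fun F _ => hF F).trans ?_
    rw [Finset.sum_add_distrib, ← Finset.sum_filter]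
    simp [M]
  have hlow := le_sum_card_hom (V := Fin n) k
  rw [Fintype.card_fin] at hlow
  have hdf := pow_le_two_pow_mul_descFactorial hkn
  have hnk : 0 < n ^ k := Nat.pow_pos (Nat.two_pow_pos r)
  -- On average a graph has twice as many homomorphisms as the assumption allows without the bad
  -- edge sets, which are too few to make up for the other half.
  have h₁ : 2 * (n ^ k * 2 ^ M) ≤ ∑ F, X F * 2 ^ (k ^ 2 + k + 1) := by
    rw [← Finset.sum_mul]
    calc 2 * (n ^ k * 2 ^ M) ≤ 2 * ((2 ^ k * n.descFactorial k) * 2 ^ M) := by gcongr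
      _ = 2 * 2 ^ k * (n.descFactorial k * 2 ^ M) := by ring
      _ ≤ 2 * 2 ^ k * ((∑ F, X F) * 2 ^ k ^ 2) := by gcongr
      _ = _ := by ring
  have h₂ : bad.card * (n ^ k * 2 ^ (k ^ 2 + k + 1)) < n ^ k * 2 ^ M :=
    calc _ = n ^ k * (bad.card * 2 ^ (k ^ 2 + k + 1)) := by ring
      _ < _ := by gcongr
  have h₃ : 2 ^ M * n ^ k = n ^ k * 2 ^ M := mul_comm _ _
  omega

lemma BicliqueFree.sup_starGraph {V : Type*} {G : SimpleGraph V} {s : ℕ}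
    (hG : BicliqueFree G s) (v : V) : BicliqueFree (G ⊔ SimpleGraph.starGraph v) (s + 1) := by
  classical
  intro X Y hadj hX
  have h := hG (X.erase v) (Y.erase v) ?_ ?_
  · have := Finset.pred_card_le_card_erase (s := Y) (a := v)
    omega
  · intro x hx y hy
    rw [Finset.mem_erase] at hx hy
    have := hadj x hx.2 y hy.2
    rw [SimpleGraph.sup_adj, SimpleGraph.starGraph_adj] at this
    tauto
  · have := Finset.pred_card_le_card_erase (s := X) (a := v)
    omega

lemma card_hom_mono {U V : Type*} [Finite U] [Finite V] (H : SimpleGraph U) {G G' : SimpleGraph V}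
    (h : G ≤ G') : Nat.card (H →g G) ≤ Nat.card (H →g G') := by
  have : Finite (H →g G') := Finite.of_injective _ (DFunLike.coe_injective (F := H →g G'))
  refine Nat.card_le_card_of_injective (fun φ => (SimpleGraph.Hom.ofLE h).comp φ) ?_
  intro φ ψ hφ
  ext a
  exact DFunLike.congr_fun hφ a

/-! ### Existence of a d-representation -/

/-- The wires of the circuit `homCircuit`. -/
def homWire {A B : Type} (H : SimpleGraph A) (G : SimpleGraph B) :
    Option ((H →g G) × Option A) → Option ((H →g G) × Option A) → Prop
  | some (_, none), none => True
  | some (φ, some _), some (ψ, none) => φ = ψ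
  | _, _ => False

lemma homWire_acyclic {A B : Type} (H : SimpleGraph A) (G : SimpleGraph B)
    (g : Option ((H →g G) × Option A)) : ¬ Relation.TransGen (homWire H G) g g := by
  let depth : Option ((H →g G) × Option A) → ℕ
    | none => 2
    | some (_, none) => 1
    | some (_, some _) => 0
  have hstep : ∀ x y, homWire H G x y → depth x < depth y := by
    rintro (_ | ⟨φ, _ | a⟩) (_ | ⟨ψ, _ | b⟩) h <;> simp_all [homWire, depth]
  have hlt : ∀ x y, Relation.TransGen (homWire H G) x y → depth x < depth y := by
    intro x y h
    induction h with
    | single h => exact hstep _ _ h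
    | tail _ h ih => exact ih.trans (hstep _ _ h)
  exact fun h => lt_irrefl _ (hlt g g h)

/-- The circuit that lists the homomorphisms: a union of products, with input gates of its own for
every homomorphism. The gate `none` is the sink, `some (φ, none)` the product gate of `φ`, and
`some (φ, some a)` the input gate labelled `{a ↦ φ a}`. -/
def homCircuit {A B : Type} [Finite A] [Nonempty A] [Finite B] (H : SimpleGraph A)
    (G : SimpleGraph B) (hne : Nonempty (H →g G)) : FactorisationCircuit A B where
  Gate := Option ((H →g G) × Option A)
  finite_gate :=
    have : Finite (H →g G) := Finite.of_injective _ (DFunLike.coe_injective (F := H →g G))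
    inferInstance
  wire := homWire H G
  acyclic := homWire_acyclic H G
  label
    | none => GateLabel.union
    | some (_, none) => GateLabel.prod
    | some (φ, some a) => GateLabel.input a (φ a)
  input_iff := by
    obtain ⟨φ₀⟩ := hne
    obtain ⟨a₀⟩ := ‹Nonempty A›
    rintro (_ | ⟨φ, _ | a⟩)
    · simp only [reduceCtorEq, exists_false, false_iff, not_forall, not_not]
      exact ⟨some (φ₀, none), trivial⟩
    · simp only [reduceCtorEq, exists_false, false_iff, not_forall, not_not]
      exact ⟨some (φ, some a₀), rfl⟩
    · simp [homWire]
  sink := none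
  sink_iff := by
    rintro (_ | ⟨φ, _ | a⟩)
    · simp [homWire]
    · simp only [reduceCtorEq, false_iff, not_forall, not_not]
      exact ⟨none, trivial⟩
    · simp only [reduceCtorEq, false_iff, not_forall, not_not]
      exact ⟨some (φ, none), rfl⟩

namespace FactorisationCircuit

lemma isDRep_homCircuit {A B : Type} [Finite A] [Nonempty A] [Finite B] (H : SimpleGraph A)
    (G : SimpleGraph B) (hne : Nonempty (H →g G)) : (homCircuit H G hne).IsDRep H G := by
  let C := homCircuit H G hne
  let P : (H →g G) → C.Gate := fun φ => some (φ, none)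
  let I : (H →g G) → A → C.Gate := fun φ a => some (φ, some a)
  have hchild : ∀ φ g, g ∈ C.children (P φ) ↔ ∃ a, g = I φ a := by
    rintro φ (_ | ⟨ψ, _ | a⟩)
    · exact ⟨False.elim, fun ⟨_, h⟩ => nomatch h⟩
    · exact ⟨False.elim, fun ⟨_, h⟩ => nomatch h⟩
    · refine ⟨fun h => ⟨a, ?_⟩, ?_⟩
      · have h : ψ = φ := h
        rw [h]
      · rintro ⟨a', h⟩
        cases h
        exact (rfl : φ = φ)
  have hsink : ∀ g, g ∈ C.children C.sink ↔ ∃ φ, g = P φ := by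
    rintro (_ | ⟨ψ, _ | a⟩)
    · exact ⟨False.elim, fun ⟨_, h⟩ => nomatch h⟩
    · exact ⟨fun _ => ⟨ψ, rfl⟩, fun _ => trivial⟩
    · exact ⟨False.elim, fun ⟨_, h⟩ => nomatch h⟩
  have hdomI : ∀ φ a a', C.MemDom (I φ a) a' ↔ a' = a := fun φ a a' =>
    memDom_input_iff (C := C) (g := I φ a) (b := φ a) rfl
  have hdomP : ∀ φ, C.dom (P φ) = Set.univ := fun φ => Set.eq_univ_of_forall fun a =>
    MemDom.child _ (I φ a) a ((hchild φ _).2 ⟨a, rfl⟩) ((hdomI φ a a).2 rfl)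
  have hI : ∀ φ a h, C.MemS (I φ a) h ↔ h = {(a, φ a)} := fun φ a h =>
    memS_input_iff (C := C) (g := I φ a) rfl
  have hP : ∀ φ h, C.MemS (P φ) h ↔ h = {p : A × B | φ p.1 = p.2} := by
    intro φ h
    have hunion : ∀ f : C.Gate → Set (A × B), (∀ a, f (I φ a) = {(a, φ a)}) →
        (⋃ g' ∈ C.children (P φ), f g') = {p : A × B | φ p.1 = p.2} := by
      intro f hf
      ext ⟨a, b⟩
      rw [Set.mem_iUnion₂]
      constructor
      · rintro ⟨g, hg, hab⟩
        obtain ⟨a', rfl⟩ := (hchild φ g).1 hg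
        rw [hf] at hab
        cases hab
        rfl
      · intro h
        have h : φ a = b := h
        refine ⟨I φ a, (hchild φ _).2 ⟨a, rfl⟩, ?_⟩
        rw [hf, h]
        rfl
    refine (memS_prod_iff (C := C) (g := P φ) rfl).trans ⟨?_, ?_⟩
    · rintro ⟨f, hf, rfl⟩
      exact hunion f fun a => (hI φ a _).1 (hf _ ((hchild φ _).2 ⟨a, rfl⟩))
    · rintro rfl
      let f : C.Gate → Set (A × B)
        | some (ψ, some a) => {(a, ψ a)}
        | _ => ∅
      refine ⟨f, fun g hg => ?_, (hunion f fun a => rfl).symm⟩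
      obtain ⟨a, rfl⟩ := (hchild φ g).1 hg
      exact (hI φ a _).2 rfl
  refine ⟨⟨?_, ?_⟩, ?_⟩
  · intro g hg g' hg'
    obtain rfl : g = C.sink := by
      rcases g with _ | ⟨φ, _ | a⟩
      · rfl
      all_goals cases hg
    obtain ⟨φ, rfl⟩ := (hsink g').1 hg'
    have hfull : C.dom C.sink = Set.univ := Set.eq_univ_of_forall fun a =>
      MemDom.child _ (P φ) a ((hsink _).2 ⟨φ, rfl⟩) ((hdomP φ).ge (Set.mem_univ a))
    exact (hdomP φ).trans hfull.symm
  · intro g hg g₁ h₁ g₂ h₂ hne'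
    obtain ⟨φ, rfl⟩ : ∃ φ, g = P φ := by
      rcases g with _ | ⟨φ, _ | a⟩
      · cases hg
      · exact ⟨φ, rfl⟩
      · cases hg
    obtain ⟨a₁, rfl⟩ := (hchild φ g₁).1 h₁
    obtain ⟨a₂, rfl⟩ := (hchild φ g₂).1 h₂
    refine Set.disjoint_left.2 fun a ha₁ ha₂ => hne' ?_
    rw [← (hdomI φ a₁ a).1 ha₁, ← (hdomI φ a₂ a).1 ha₂]
  · ext h
    refine (memS_union_iff (C := C) (g := C.sink) rfl).trans ⟨?_, ?_⟩
    · rintro ⟨g, hg, hh⟩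
      obtain ⟨φ, rfl⟩ := (hsink g).1 hg
      exact ⟨φ, (hP φ h).1 hh⟩
    · rintro ⟨φ, hφ⟩
      exact ⟨P φ, (hsink _).2 ⟨φ, rfl⟩, (hP φ h).2 hφ⟩

end FactorisationCircuit

/-! ### The size bound in terms of the number of edges -/

lemma mul_rpow_div_log_pow_le {k r m S K : ℕ} (hk : 1 ≤ k) (hr : 5 ≤ r) (hm : m ≤ (2 ^ r) ^ 2)
    (hm' : 2 ^ (r - 1) ≤ m) (hS : (2 ^ r) ^ k ≤ S * (2 * (2 * r + 1)) ^ k * 2 ^ K) :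
    1 / (2 ^ K * 20 ^ k) * ((m : ℝ) ^ ((k : ℝ) / 2) / Real.log (m : ℝ) ^ (3 * k - 1)) ≤
      (S : ℝ) := by
  set L := Real.log (m : ℝ) with hL
  have hr' : (5 : ℝ) ≤ r := by exact_mod_cast hr
  have hlog : ((r : ℝ) - 1) * Real.log 2 ≤ L := by
    have h₁ : ((2 : ℝ) ^ (r - 1)) ≤ m := by exact_mod_cast hm'
    have h₂ := Real.log_le_log (by positivity) h₁
    rw [Real.log_pow, Nat.cast_sub (by omega)] at h₂
    simpa using h₂
  have hL₀ : ((r : ℝ) - 1) * (1 / 2) ≤ L := by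
    have := Real.log_two_gt_d9
    nlinarith
  have hL₁ : 1 ≤ L := by linarith
  have hrL : 2 * (2 * (r : ℝ) + 1) ≤ 20 * L := by linarith
  have hpow : L ^ k ≤ L ^ (3 * k - 1) := pow_le_pow_right₀ hL₁ (by omega)
  have hmn : (m : ℝ) ^ ((k : ℝ) / 2) ≤ ((2 : ℝ) ^ r) ^ k := by
    have h₁ : (m : ℝ) ≤ ((2 : ℝ) ^ r) ^ 2 := by exact_mod_cast hm
    refine (Real.rpow_le_rpow (by positivity) h₁ (by positivity)).trans_eq ?_
    rw [← Real.rpow_natCast _ 2, ← Real.rpow_mul (by positivity)]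
    rw [show ((2 : ℕ) : ℝ) * ((k : ℝ) / 2) = k by push_cast; ring, Real.rpow_natCast]
  have hS' : ((2 : ℝ) ^ r) ^ k ≤ S * (2 * (2 * r + 1)) ^ k * 2 ^ K := by exact_mod_cast hS
  have hLpos : 0 < L ^ (3 * k - 1) := by positivity
  rw [div_mul_div_comm, one_mul, div_le_iff₀ (by positivity)]
  calc (m : ℝ) ^ ((k : ℝ) / 2) ≤ S * (2 * (2 * r + 1)) ^ k * 2 ^ K := hmn.trans hS'
    _ ≤ S * (20 * L) ^ k * 2 ^ K := by gcongr
    _ = S * (2 ^ K * 20 ^ k * L ^ k) := by rw [mul_pow]; ring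
    _ ≤ S * (2 ^ K * 20 ^ k * L ^ (3 * k - 1)) := by gcongr

theorem theorem3 (k : ℕ) (hk : 1 ≤ k) :
    ∃ c : ℝ, 0 < c ∧ ∀ N : ℕ, ∃ (n : ℕ) (G : SimpleGraph (Fin n)) (m : ℕ),
      G.Connected ∧ m = G.edgeSet.ncard ∧ N ≤ m ∧
      (∃ C : FactorisationCircuit (Fin k) (Fin n), C.IsDRep (⊤ : SimpleGraph (Fin k)) G) ∧
      ∀ C : FactorisationCircuit (Fin k) (Fin n), C.IsDRep (⊤ : SimpleGraph (Fin k)) G →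
        c * ((m : ℝ) ^ ((k : ℝ) / 2) / Real.log (m : ℝ) ^ (3 * k - 1)) ≤ (C.size : ℝ) := by
  classical
  refine ⟨1 / (2 ^ (k ^ 2 + k + 1) * 20 ^ k), by positivity, fun N => ?_⟩
  obtain ⟨r, hr⟩ : ∃ r, r = N + (k ^ 2 + k + 1) + 5 := ⟨_, rfl⟩
  obtain ⟨R, hR, hRhom⟩ := exists_bicliqueFree_card_hom (k := k) (r := r) (by omega)
  have : NeZero (2 ^ r) := ⟨by positivity⟩
  -- A universal vertex makes the graph connected and adds at most one vertex to each side of a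
  -- complete bipartite subgraph.
  let G : SimpleGraph (Fin (2 ^ r)) := R ⊔ SimpleGraph.starGraph 0
  have hG : BicliqueFree G (2 * r + 1 + 1) := hR.sup_starGraph 0
  have hconn : G.Connected := (SimpleGraph.connected_starGraph 0).mono le_sup_right
  have hhom : (2 ^ r) ^ k ≤
      Nat.card ((⊤ : SimpleGraph (Fin k)) →g G) * 2 ^ (k ^ 2 + k + 1) :=
    hRhom.trans (Nat.mul_le_mul_right _ (card_hom_mono _ le_sup_left))
  have hm : G.edgeSet.ncard ≤ (2 ^ r) ^ 2 := by
    rw [← SimpleGraph.coe_edgeFinset, Set.ncard_coe_finset]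
    refine SimpleGraph.card_edgeFinset_le_card_choose_two.trans ?_
    simpa using Nat.choose_le_pow (2 ^ r) 2
  have hm' : 2 ^ r ≤ G.edgeSet.ncard + 1 := by
    have := hconn.card_vert_le_card_edgeSet_add_one
    rwa [Nat.card_eq_fintype_card, Fintype.card_fin] at this
  have hNr : r < 2 ^ r := Nat.lt_two_pow_self
  have hpow : 2 ^ r = 2 ^ (r - 1) * 2 := by rw [← pow_succ]; congr 1; omega
  have hpos : 0 < 2 ^ (r - 1) := by positivity
  refine ⟨2 ^ r, G, G.edgeSet.ncard, hconn, rfl, by omega, ?_, fun C hC => ?_⟩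
  · have : Nonempty (Fin k) := ⟨⟨0, hk⟩⟩
    have hne : Nonempty ((⊤ : SimpleGraph (Fin k)) →g G) := by
      by_contra h
      rw [not_nonempty_iff] at h
      rw [Nat.card_of_isEmpty, zero_mul] at hhom
      exact absurd hhom (not_le.2 (Nat.pow_pos (Nat.two_pow_pos r)))
    exact ⟨_, FactorisationCircuit.isDRep_homCircuit _ _ hne⟩
  · refine mul_rpow_div_log_pow_le hk (by omega) hm (by omega) (hhom.trans ?_)
    have := FactorisationCircuit.card_hom_le_size_mul hG (by omega) hC
    rw [Fintype.card_fin] at this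
    exact Nat.mul_le_mul_right _ this
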